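/- Let $M$ be a smooth, compact, connected manifold (oriented or not) of dimension $n$, let $\omega_1,\dots,\omega_m$ be smooth complex closed $1$-forms on $M$, let $\mathbb{T}^m=\mathbb{R}^m/2\pi\mathbb{Z}^m$ with usual coordinates $x=(x_1,\dots,x_m)$, and let $\Omega=M\times\mathbb{T}^m$. Let $\Lambda^q$ be the bundle of complex $q$-forms on $M$ and $\underline{\Lambda}^q$ its pullback to $\Omega$ by the projection $\Omega\to M$. Consider the complexes $$\mathrm{d}'=\mathrm{d}_t+\sum_{k=1}^m\omega_k\wedge\frac{\partial}{\partial x_k}:\mathscr{C}^\infty(\Omega;\underline{\Lambda}^q)\to\mathscr{C}^\infty(\Omega;\underline{\Lambda}^{q+1}),$$ where $\mathrm{d}_t$ is the exterior derivative in the variables of $M$, and, for $\xi\in\mathbb{Z}^m$, $$\mathrm{d}'_\xi f=\mathrm{d}f+i\Big(\sum_{k=1}^m\xi_k\omega_k\Big)\wedge f,\qquad \mathrm{d}'_\xi:\mathscr{C}^\infty(M;\Lambda^q)\to\mathscr{C}^\infty(M;\Lambda^{q+1}).$$ Let $H^q_{\mathrm{d}'}(\mathscr{C}^\infty(\Omega))$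 and $H^q_\xi(\mathscr{C}^\infty(M))$ be their cohomology spaces in degree $q$ (kernel modulo range, both complexes being completed by zero in negative degrees). For $\xi\in\mathbb{Z}^m$ let $$\mathcal{E}_\xi:\mathscr{C}^\infty(M;\Lambda^q)\to\mathscr{C}^\infty(\Omega;\underline{\Lambda}^q),\qquad \mathcal{E}_\xi f=(2\pi)^{-m}e^{ix\xi}f .$$ Then, for every degree $q\ge 0$: 1. for each $\xi\in\mathbb{Z}^m$, $\mathcal{E}_\xi$ maps $\mathrm{d}'_\xi$-closed forms to $\mathrm{d}'$-closed sections, and $[f]\mapsto[\mathcal{E}_\xi f]$ is a well-defined injective linear map $H^q_\xi(\mathscr{C}^\infty(M))\to H^q_{\mathrm{d}'}(\mathscr{C}^\infty(\Omega))$; 2. the linear map $\bigoplus_{\xi\in\mathbb{Z}^m}H^q_\xi(\mathscr{C}^\infty(M))\to H^q_{\mathrm{d}'}(\mathscr{C}^\infty(\Omega))$ whose restriction to the summand of index $\xi$ is the map of part 1 is injective. -/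

import Mathlib

open scoped Manifold ContDiff Topology

noncomputable section

namespace TubeStructure

/-! ### Pointwise exterior algebra -/

section Pointwise

variable {E : Type*} [NormedAddCommGroup E] [NormedSpace ℝ E] {q : ℕ}

/-- Exterior product of a complex covector with a complex alternating form of degree `q`:
`(α ∧ f) (v₀, …, v_q) = ∑ i, (-1) ^ i * α (v_i) * f (v₀, …, v̂_i, …, v_q)`. -/
def wedgeOne (α : E [⋀^Fin 1]→L[ℝ] ℂ) (f : E [⋀^Fin q]→L[ℝ] ℂ) : E [⋀^Fin (q + 1)]→L[ℝ] ℂ :=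
  ContinuousAlternatingMap.alternatizeUncurryFin
    (((ContinuousAlternatingMap.ofSubsingleton ℝ E ℂ (0 : Fin 1)).symm α).smulRight f)

theorem wedgeOne_apply (α : E [⋀^Fin 1]→L[ℝ] ℂ) (f : E [⋀^Fin q]→L[ℝ] ℂ)
    (v : Fin (q + 1) → E) :
    wedgeOne α f v = ∑ i : Fin (q + 1), (-1 : ℂ) ^ (i : ℕ) * (α (fun _ => v i) * f (i.removeNth v)) := by
  simp [wedgeOne, ContinuousAlternatingMap.alternatizeUncurryFin_apply]

end Pointwise

/-- The torus `ℝ^m / 2πℤ^m`. -/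
abbrev Torus (m : ℕ) : Type := Fin m → AddCircle (2 * Real.pi)

/-- The projection `ℝ^m → ℝ^m / 2πℤ^m`. -/
def torusMk {m : ℕ} (x : Fin m → ℝ) : Torus m := fun k => (x k : AddCircle (2 * Real.pi))

/-- The character `x ↦ e^{i x ξ}` of the torus. -/
def torusChar {m : ℕ} (ξ : Fin m → ℤ) (x : Torus m) : ℂ := ∏ k, fourier (ξ k) (x k)

theorem torusChar_torusMk {m : ℕ} (ξ : Fin m → ℤ) (x : Fin m → ℝ) :
    torusChar ξ (torusMk x) = Complex.exp (Complex.I * ∑ k, (x k : ℂ) * (ξ k : ℂ)) := by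
  have hpi : (Real.pi : ℂ) ≠ 0 := by exact_mod_cast Real.pi_ne_zero
  rw [Finset.mul_sum, Complex.exp_sum]
  refine Finset.prod_congr rfl fun k _ => ?_
  rw [torusMk, fourier_coe_apply]
  congr 1
  push_cast
  field_simp

section Manifold

variable (n m : ℕ) (M : Type*) [TopologicalSpace M] [ChartedSpace (EuclideanSpace ℝ (Fin n)) M]

/-- Complex differential forms of degree `q` on `M`, without any regularity. -/
abbrev RawForm (q : ℕ) : Type _ := (t : M) → (TangentSpace (𝓡 n) t) [⋀^Fin q]→L[ℝ] ℂ

/-- Sections over `M × 𝕋^m` of the pullback of the bundle of complex `q`-forms of `M`,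
without any regularity. -/
abbrev RawSection (q : ℕ) : Type _ :=
  (p : M × Torus m) → (TangentSpace (𝓡 n) p.1) [⋀^Fin q]→L[ℝ] ℂ

variable {n m M} {q : ℕ}

/-- The local representative of a form `f` in the chart `φ` of `M` centred at `t₀`: the pullback
`(φ⁻¹)^* f`, a form on the (open) target of `φ` in `ℝ^n`. -/
def chartRep (t₀ : M) (f : RawForm n M q) (y : EuclideanSpace ℝ (Fin n)) :
    EuclideanSpace ℝ (Fin n) [⋀^Fin q]→L[ℝ] ℂ :=
  (f ((extChartAt (𝓡 n) t₀).symm y)).compContinuousLinearMap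
    (mfderiv (𝓡 n) (𝓡 n) (extChartAt (𝓡 n) t₀).symm y)

/-- A form is smooth if it is smooth in the charts of `M`. -/
def IsSmoothForm (f : RawForm n M q) : Prop :=
  ∀ t₀ : M, ContDiffOn ℝ ∞ (chartRep t₀ f) (extChartAt (𝓡 n) t₀).target

/-- The exterior derivative of a form on `M`, computed at `t` in the chart centred at `t`
(by `chartRep_extD` below, any other chart gives the same form). -/
def extD (f : RawForm n M q) : RawForm n M (q + 1) := fun t =>
  (extDeriv (chartRep t f) (extChartAt (𝓡 n) t t)).compContinuousLinearMap
    (mfderiv (𝓡 n) (𝓡 n) (extChartAt (𝓡 n) t) t)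

/-- The exterior product `w ∧ f` of a `1`-form and a `q`-form. -/
def wedge (w : RawForm n M 1) (f : RawForm n M q) : RawForm n M (q + 1) := fun t =>
  wedgeOne (E := EuclideanSpace ℝ (Fin n)) (w t) (f t)

/-- The form `f(·, x)` on `M`, for `x ∈ 𝕋^m` fixed. -/
def slice (f : RawSection n m M q) (x : Torus m) : RawForm n M q := fun t => f (t, x)

/-- The local representative of a section over `M × 𝕋^m`, in a chart of `M` and in the coordinates
`x ∈ ℝ^m` of the torus. -/
def sectionRep (t₀ : M) (f : RawSection n m M q)
    (p : EuclideanSpace ℝ (Fin n) × (Fin m → ℝ)) : EuclideanSpace ℝ (Fin n) [⋀^Fin q]→L[ℝ] ℂ :=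
  chartRep t₀ (slice f (torusMk p.2)) p.1

/-- A section over `M × 𝕋^m` is smooth if its coefficients are smooth in `(t, x)`, where `t` are
local coordinates of `M` and `x ∈ ℝ^m` are the usual coordinates of the torus (for the quotient
smooth structure, `ℝ^m → 𝕋^m` is a surjective local diffeomorphism). -/
def IsSmoothSection (f : RawSection n m M q) : Prop :=
  ∀ t₀ : M, ContDiffOn ℝ ∞ (sectionRep t₀ f) ((extChartAt (𝓡 n) t₀).target ×ˢ Set.univ)

/-- The exterior derivative `d_t` in the variables of `M`. -/
def dT (f : RawSection n m M q) : RawSection n m M (q + 1) := fun p => extD (slice f p.2) p.1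

/-- The partial derivative `∂/∂x_k` along the torus. -/
def torusDeriv (k : Fin m) (f : RawSection n m M q) : RawSection n m M q := fun p =>
  deriv (fun s : ℝ => f (p.1, p.2 + Pi.single k (s : AddCircle (2 * Real.pi)))) 0

/-- `d' f = d_t f + ∑ k, w_k ∧ ∂f/∂x_k`. -/
def dPrimeRaw (w : Fin m → RawForm n M 1) (f : RawSection n m M q) : RawSection n m M (q + 1) :=
  dT f + ∑ k, fun p => wedge (w k) (slice (torusDeriv k f) p.2) p.1

/-- `E_ξ f = (2π)^{-m} e^{i x ξ} f`. -/
def embedRaw (ξ : Fin m → ℤ) (f : RawForm n M q) : RawSection n m M q := fun p =>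
  (((2 * Real.pi : ℂ) ^ m)⁻¹ * torusChar ξ p.2) • f p.1

/-! ### Smoothness and linearity of the operators -/

theorem chartRep_add (t₀ : M) (f g : RawForm n M q) :
    chartRep t₀ (f + g) = chartRep t₀ f + chartRep t₀ g := rfl

theorem chartRep_smul (t₀ : M) (c : ℂ) (f : RawForm n M q) :
    chartRep t₀ (c • f) = c • chartRep t₀ f := rfl


theorem mdiffAt_symm [IsManifold (𝓡 n) ∞ M] (t₀ : M) {y : EuclideanSpace ℝ (Fin n)}
    (hy : y ∈ (extChartAt (𝓡 n) t₀).target) :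
    MDifferentiableAt (𝓡 n) (𝓡 n) (extChartAt (𝓡 n) t₀).symm y :=
  ((contMDiffOn_extChartAt_symm (I := 𝓡 n) (n := ∞) t₀).contMDiffAt
    ((isOpen_extChartAt_target t₀).mem_nhds hy)).mdifferentiableAt (by simp)

theorem isInvertible_mfderiv_symm [IsManifold (𝓡 n) ∞ M] (t₀ : M)
    {y : EuclideanSpace ℝ (Fin n)} (hy : y ∈ (extChartAt (𝓡 n) t₀).target) :
    (mfderiv (𝓡 n) (𝓡 n) (extChartAt (𝓡 n) t₀).symm y).IsInvertible := by
  have h := isInvertible_mfderivWithin_extChartAt_symm (I := 𝓡 n) hy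
  simpa [mfderivWithin_univ] using h

theorem IsSmoothForm.differentiableAt {f : RawForm n M q} (hf : IsSmoothForm f) (t₀ : M)
    {y : EuclideanSpace ℝ (Fin n)} (hy : y ∈ (extChartAt (𝓡 n) t₀).target) :
    DifferentiableAt ℝ (chartRep t₀ f) y :=
  ((hf t₀).contDiffAt ((isOpen_extChartAt_target t₀).mem_nhds hy)).differentiableAt (by simp)

theorem chartRep_extD [IsManifold (𝓡 n) ∞ M] (t₀ : M) {f : RawForm n M q} (hf : IsSmoothForm f)
    {y : EuclideanSpace ℝ (Fin n)} (hy : y ∈ (extChartAt (𝓡 n) t₀).target) :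
    chartRep t₀ (extD f) y = extDeriv (chartRep t₀ f) y := by
  set t := (extChartAt (𝓡 n) t₀).symm y with ht
  set τ : EuclideanSpace ℝ (Fin n) → EuclideanSpace ℝ (Fin n) :=
    fun z => extChartAt (𝓡 n) t ((extChartAt (𝓡 n) t₀).symm z) with hτ
  have hsrc : ∀ᶠ z in 𝓝 y, z ∈ (extChartAt (𝓡 n) t₀).target ∧
      (extChartAt (𝓡 n) t₀).symm z ∈ (extChartAt (𝓡 n) t).source := by
    have h1 : ∀ᶠ z in 𝓝 y, z ∈ (extChartAt (𝓡 n) t₀).target :=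
      (isOpen_extChartAt_target t₀).mem_nhds hy
    exact h1.and <| (mdiffAt_symm t₀ hy).continuousAt.preimage_mem_nhds
      ((isOpen_extChartAt_source t).mem_nhds (mem_extChartAt_source t))
  have hτsm : ContDiffAt ℝ ∞ τ y := by
    rw [← contMDiffAt_iff_contDiffAt]
    exact ContMDiffAt.comp y (contMDiffAt_extChartAt (I := 𝓡 n) (n := ∞) (x := t))
      ((contMDiffOn_extChartAt_symm (I := 𝓡 n) (n := ∞) t₀).contMDiffAt
        ((isOpen_extChartAt_target t₀).mem_nhds hy))
  have hcomp : ∀ z, z ∈ (extChartAt (𝓡 n) t₀).target →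
      (extChartAt (𝓡 n) t₀).symm z ∈ (extChartAt (𝓡 n) t).source →
      (mfderiv (𝓡 n) (𝓡 n) (extChartAt (𝓡 n) t) ((extChartAt (𝓡 n) t₀).symm z)).comp
        (mfderiv (𝓡 n) (𝓡 n) (extChartAt (𝓡 n) t₀).symm z) = fderiv ℝ τ z := by
    intro z hz hz'
    rw [← mfderiv_eq_fderiv]
    refine (mfderiv_comp z ?_ (mdiffAt_symm t₀ hz)).symm
    exact mdifferentiableAt_extChartAt (by simpa using hz')
  have hev : chartRep t₀ f =ᶠ[𝓝 y]
      fun z => (chartRep t f (τ z)).compContinuousLinearMap (fderiv ℝ τ z) := by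
    filter_upwards [hsrc] with z hz
    have hτz : τ z ∈ (extChartAt (𝓡 n) t).target := (extChartAt (𝓡 n) t).map_source hz.2
    have hinv : (extChartAt (𝓡 n) t).symm (τ z) = (extChartAt (𝓡 n) t₀).symm z :=
      (extChartAt (𝓡 n) t).left_inv hz.2
    have hgerm : (extChartAt (𝓡 n) t₀).symm =ᶠ[𝓝 z] (extChartAt (𝓡 n) t).symm ∘ τ := by
      have : ∀ᶠ z' in 𝓝 z, (extChartAt (𝓡 n) t₀).symm z' ∈ (extChartAt (𝓡 n) t).source :=
        (mdiffAt_symm t₀ hz.1).continuousAt.preimage_mem_nhds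
          ((isOpen_extChartAt_source t).mem_nhds hz.2)
      filter_upwards [this] with z' hz'
      exact ((extChartAt (𝓡 n) t).left_inv hz').symm
    have hτd : MDifferentiableAt (𝓡 n) (𝓡 n) τ z :=
      MDifferentiableAt.comp z (mdifferentiableAt_extChartAt (by simpa using hz.2))
        (mdiffAt_symm t₀ hz.1)
    have hder : (mfderiv (𝓡 n) (𝓡 n) (extChartAt (𝓡 n) t₀).symm z :
          EuclideanSpace ℝ (Fin n) →L[ℝ] EuclideanSpace ℝ (Fin n)) =
        ContinuousLinearMap.comp
          (mfderiv (𝓡 n) (𝓡 n) (extChartAt (𝓡 n) t).symm (τ z) :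
            EuclideanSpace ℝ (Fin n) →L[ℝ] EuclideanSpace ℝ (Fin n)) (fderiv ℝ τ z) := by
      have h2 := mfderiv_comp z (mdiffAt_symm t hτz) hτd
      rw [← hgerm.mfderiv_eq, mfderiv_eq_fderiv] at h2
      exact h2
    have key : ∀ (a b : M) (_ : a = b) (L L' : EuclideanSpace ℝ (Fin n) →L[ℝ]
        EuclideanSpace ℝ (Fin n)) (_ : L = L'),
        (show EuclideanSpace ℝ (Fin n) [⋀^Fin q]→L[ℝ] ℂ from f a).compContinuousLinearMap L =
        (show EuclideanSpace ℝ (Fin n) [⋀^Fin q]→L[ℝ] ℂ from f b).compContinuousLinearMap L' := by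
      rintro a _ rfl L _ rfl; rfl
    exact key _ _ hinv.symm _ _ hder
  rw [hev.extDeriv_eq, extDeriv_pullback (r := ∞) (f := τ)
    (hf.differentiableAt t (mem_extChartAt_target t)) hτsm (by simp; exact WithTop.coe_le_coe.2 le_top)]
  have hc := hcomp y hy (mem_extChartAt_source t)
  rw [← hc]
  rfl

theorem isOpen_target_prod (t₀ : M) :
    IsOpen ((extChartAt (𝓡 n) t₀).target ×ˢ (Set.univ : Set (Fin m → ℝ))) :=
  (isOpen_extChartAt_target t₀).prod isOpen_univ

theorem torusMk_surjective : Function.Surjective (torusMk (m := m)) := by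
  intro x
  choose s hs using fun k => QuotientAddGroup.mk_surjective (x k)
  exact ⟨s, funext hs⟩

theorem torusMk_add_single (x : Fin m → ℝ) (k : Fin m) (s : ℝ) :
    torusMk x + Pi.single k (s : AddCircle (2 * Real.pi)) = torusMk (x + s • Pi.single k 1) := by
  funext j
  rcases eq_or_ne j k with rfl | h
  · simp [torusMk]
  · simp [torusMk, h]

theorem IsSmoothSection.contDiffAt {f : RawSection n m M q} (hf : IsSmoothSection f) (t₀ : M)
    {p : EuclideanSpace ℝ (Fin n) × (Fin m → ℝ)} (hp : p.1 ∈ (extChartAt (𝓡 n) t₀).target) :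
    ContDiffAt ℝ ∞ (sectionRep t₀ f) p :=
  (hf t₀).contDiffAt ((isOpen_target_prod t₀).mem_nhds ⟨hp, trivial⟩)

theorem IsSmoothSection.slice {f : RawSection n m M q} (hf : IsSmoothSection f) (x : Torus m) :
    IsSmoothForm (slice f x) := by
  obtain ⟨x, rfl⟩ := torusMk_surjective x
  intro t₀
  have h := (hf t₀).comp (f := fun y : EuclideanSpace ℝ (Fin n) => (y, x))
    (s := (extChartAt (𝓡 n) t₀).target) (by fun_prop) (fun y hy => ⟨hy, trivial⟩)
  exact h

theorem IsSmoothSection.differentiableAt_left {f : RawSection n m M q} (hf : IsSmoothSection f)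
    (t₀ : M) {p : EuclideanSpace ℝ (Fin n) × (Fin m → ℝ)}
    (hp : p.1 ∈ (extChartAt (𝓡 n) t₀).target) :
    DifferentiableAt ℝ (fun y => sectionRep t₀ f (y, p.2)) p.1 :=
  (hf.slice (torusMk p.2)).differentiableAt t₀ hp

theorem chartRep_wedge (t₀ : M) (w : RawForm n M 1) (f : RawForm n M q)
    (y : EuclideanSpace ℝ (Fin n)) :
    chartRep t₀ (wedge w f) y = wedgeOne (chartRep t₀ w y) (chartRep t₀ f y) := by
  ext v
  simp only [chartRep, wedge]
  erw [ContinuousAlternatingMap.compContinuousLinearMap_apply, wedgeOne_apply, wedgeOne_apply]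
  rfl

theorem deriv_pullback_equiv (g : ℝ → EuclideanSpace ℝ (Fin n) [⋀^Fin q]→L[ℝ] ℂ)
    (L : EuclideanSpace ℝ (Fin n) ≃L[ℝ] EuclideanSpace ℝ (Fin n))
    {D : EuclideanSpace ℝ (Fin n) [⋀^Fin q]→L[ℝ] ℂ}
    (h : HasDerivAt (fun s => (g s).compContinuousLinearMap (L : _ →L[ℝ] _)) D 0) :
    (deriv g 0).compContinuousLinearMap (L : _ →L[ℝ] _) = D := by
  have h2 := (ContinuousAlternatingMap.compContinuousLinearMapCLM (ι := Fin q) (F := ℂ)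
    (L.symm : EuclideanSpace ℝ (Fin n) →L[ℝ] EuclideanSpace ℝ (Fin n))).hasFDerivAt.comp_hasDerivAt
      (0 : ℝ) h
  have h3 : g = (ContinuousAlternatingMap.compContinuousLinearMapCLM (ι := Fin q) (F := ℂ)
    (L.symm : EuclideanSpace ℝ (Fin n) →L[ℝ] EuclideanSpace ℝ (Fin n))) ∘
      fun s => (g s).compContinuousLinearMap (L : _ →L[ℝ] _) := by
    funext s; ext v; simp [Function.comp_def]
  rw [← h3] at h2
  rw [h2.deriv]
  ext v; simp [Function.comp_def]

theorem chartRep_torusDeriv [IsManifold (𝓡 n) ∞ M] (t₀ : M) (k : Fin m)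
    {f : RawSection n m M q} (hf : IsSmoothSection f)
    {p : EuclideanSpace ℝ (Fin n) × (Fin m → ℝ)} (hp : p.1 ∈ (extChartAt (𝓡 n) t₀).target) :
    sectionRep t₀ (torusDeriv k f) p =
      fderiv ℝ (sectionRep t₀ f) p (0, Pi.single k 1) := by
  obtain ⟨y, x⟩ := p
  have hd : HasFDerivAt (sectionRep t₀ f) (fderiv ℝ (sectionRep t₀ f) (y, x)) (y, x) :=
    ((hf.contDiffAt t₀ hp).differentiableAt (by simp)).hasFDerivAt
  have hl : HasDerivAt (fun s : ℝ => sectionRep t₀ f (y, x + s • Pi.single k 1))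
      (fderiv ℝ (sectionRep t₀ f) (y, x) (0, Pi.single k 1)) 0 := by
    have h1 : HasDerivAt (fun s : ℝ => (y, x + s • (Pi.single k 1 : Fin m → ℝ)))
        (0, Pi.single k 1) (0 : ℝ) := by
      refine (hasDerivAt_const _ _).prodMk ?_
      simpa using ((hasDerivAt_id (0 : ℝ)).smul_const (Pi.single k 1 : Fin m → ℝ)).const_add x
    have h2 : HasFDerivAt (sectionRep t₀ f) (fderiv ℝ (sectionRep t₀ f) (y, x))
        (y, x + (0 : ℝ) • (Pi.single k 1 : Fin m → ℝ)) := by simpa using hd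
    exact h2.comp_hasDerivAt (0 : ℝ) h1
  obtain ⟨L, hL⟩ : ∃ L : EuclideanSpace ℝ (Fin n) ≃L[ℝ] EuclideanSpace ℝ (Fin n),
      (L : EuclideanSpace ℝ (Fin n) →L[ℝ] EuclideanSpace ℝ (Fin n)) =
        mfderiv (𝓡 n) (𝓡 n) (extChartAt (𝓡 n) t₀).symm y := isInvertible_mfderiv_symm t₀ hp
  have hrep : ∀ s : ℝ, sectionRep t₀ f (y, x + s • Pi.single k 1) =
      (show EuclideanSpace ℝ (Fin n) [⋀^Fin q]→L[ℝ] ℂ from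
        f ((extChartAt (𝓡 n) t₀).symm y,
          torusMk x + Pi.single k (s : AddCircle (2 * Real.pi)))).compContinuousLinearMap
        (L : _ →L[ℝ] _) := by
    intro s
    rw [torusMk_add_single, sectionRep, chartRep]
    dsimp only
    rw [← hL]
    rfl
  simp_rw [hrep] at hl
  have h4 := deriv_pullback_equiv _ L hl
  rw [← h4, sectionRep, chartRep]
  dsimp only
  rw [← hL]
  rfl

theorem contDiff_wedgeOne {X : Type*} [NormedAddCommGroup X] [NormedSpace ℝ X]
    {a : X → EuclideanSpace ℝ (Fin n) [⋀^Fin 1]→L[ℝ] ℂ}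
    {b : X → EuclideanSpace ℝ (Fin n) [⋀^Fin q]→L[ℝ] ℂ} {s : Set X}
    (ha : ContDiffOn ℝ ∞ a s) (hb : ContDiffOn ℝ ∞ b s) :
    ContDiffOn ℝ ∞ (fun x => wedgeOne (a x) (b x)) s := by
  have ha' : ContDiffOn ℝ ∞ (fun x => (ContinuousAlternatingMap.ofSubsingletonLIE
      (𝕜 := ℝ) (E := EuclideanSpace ℝ (Fin n)) (F := ℂ) (0 : Fin 1)).symm (a x)) s :=
    (LinearIsometryEquiv.contDiff _).comp_contDiffOn ha
  have hb' : ContDiffOn ℝ ∞ (fun x => (ContinuousLinearMap.lsmul ℝ ℂ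
      (E := EuclideanSpace ℝ (Fin n) [⋀^Fin q]→L[ℝ] ℂ)).flip (b x)) s :=
    (ContinuousLinearMap.contDiff _).comp_contDiffOn hb
  exact (ContinuousAlternatingMap.alternatizeUncurryFinCLM ℝ
    (EuclideanSpace ℝ (Fin n)) ℂ).contDiff.comp_contDiffOn (hb'.clm_comp ha')

theorem IsSmoothSection.contDiffOn_extDeriv {f : RawSection n m M q} (hf : IsSmoothSection f)
    (t₀ : M) :
    ContDiffOn ℝ ∞ (fun p : EuclideanSpace ℝ (Fin n) × (Fin m → ℝ) =>
      extDeriv (chartRep t₀ (TubeStructure.slice f (torusMk p.2))) p.1)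
      ((extChartAt (𝓡 n) t₀).target ×ˢ Set.univ) := by
  have h1 : ContDiffOn ℝ ∞ (fderiv ℝ (sectionRep t₀ f))
      ((extChartAt (𝓡 n) t₀).target ×ˢ Set.univ) :=
    (hf t₀).fderiv_of_isOpen (isOpen_target_prod t₀) (by simp)
  have h2 : ContDiffOn ℝ ∞ (fun p => ContinuousAlternatingMap.alternatizeUncurryFinCLM ℝ
      (EuclideanSpace ℝ (Fin n)) ℂ ((fderiv ℝ (sectionRep t₀ f) p).comp
        (ContinuousLinearMap.inl ℝ (EuclideanSpace ℝ (Fin n)) (Fin m → ℝ))))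
      ((extChartAt (𝓡 n) t₀).target ×ˢ Set.univ) :=
    (ContinuousLinearMap.contDiff _).comp_contDiffOn (h1.clm_comp contDiffOn_const)
  refine h2.congr ?_
  rintro ⟨y, x⟩ ⟨hy, -⟩
  have hd := ((hf.contDiffAt t₀ (p := (y, x)) hy).differentiableAt (by simp)).hasFDerivAt
  have h3 := (hd.comp y (hasFDerivAt_prodMk_left (𝕜 := ℝ) y x)).fderiv
  rw [ContinuousAlternatingMap.alternatizeUncurryFinCLM_apply, ← h3]
  rfl

theorem IsSmoothSection.add {f g : RawSection n m M q} (hf : IsSmoothSection f)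
    (hg : IsSmoothSection g) : IsSmoothSection (f + g) := fun t₀ => (hf t₀).add (hg t₀)

theorem isSmoothSection_zero : IsSmoothSection (0 : RawSection n m M q) :=
  fun _ => contDiffOn_const (c := (0 : EuclideanSpace ℝ (Fin n) [⋀^Fin q]→L[ℝ] ℂ))

theorem IsSmoothSection.smul {f : RawSection n m M q} (c : ℂ) (hf : IsSmoothSection f) :
    IsSmoothSection (c • f) := fun t₀ => (hf t₀).const_smul c

theorem IsSmoothSection.dT [IsManifold (𝓡 n) ∞ M] {f : RawSection n m M q}
    (hf : IsSmoothSection f) : IsSmoothSection (dT f) := fun t₀ =>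
  (hf.contDiffOn_extDeriv t₀).congr fun _ hp => chartRep_extD t₀ (hf.slice _) hp.1

theorem sectionRep_wedge (t₀ : M) (w : RawForm n M 1) (f : RawSection n m M q)
    (p : EuclideanSpace ℝ (Fin n) × (Fin m → ℝ)) :
    sectionRep t₀ (fun p => wedge w (slice f p.2) p.1) p =
      wedgeOne (chartRep t₀ w p.1) (sectionRep t₀ f p) :=
  chartRep_wedge t₀ w _ p.1

theorem sectionRep_sum {ι : Type*} (t₀ : M) (s : Finset ι) (f : ι → RawSection n m M q) :
    sectionRep t₀ (∑ k ∈ s, f k) = ∑ k ∈ s, sectionRep t₀ (f k) :=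
  map_sum (⟨⟨sectionRep t₀, rfl⟩, fun _ _ => rfl⟩ :
    RawSection n m M q →+ (EuclideanSpace ℝ (Fin n) × (Fin m → ℝ) → _)) f s

theorem sectionRep_dPrimeRaw [IsManifold (𝓡 n) ∞ M] (w : Fin m → RawForm n M 1)
    {f : RawSection n m M q} (hf : IsSmoothSection f) (t₀ : M)
    {p : EuclideanSpace ℝ (Fin n) × (Fin m → ℝ)} (hp : p.1 ∈ (extChartAt (𝓡 n) t₀).target) :
    sectionRep t₀ (dPrimeRaw w f) p =
      extDeriv (fun y => sectionRep t₀ f (y, p.2)) p.1 +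
        ∑ k, wedgeOne (chartRep t₀ (w k) p.1) (fderiv ℝ (sectionRep t₀ f) p (0, Pi.single k 1)) := by
  have h1 : sectionRep t₀ (dPrimeRaw w f) p = sectionRep t₀ (TubeStructure.dT f) p +
      sectionRep t₀ (∑ k, fun p => wedge (w k) (slice (torusDeriv k f) p.2) p.1) p := rfl
  rw [h1, sectionRep_sum, Finset.sum_apply]
  simp_rw [sectionRep_wedge, chartRep_torusDeriv t₀ _ hf hp]
  congr 1
  exact chartRep_extD t₀ (hf.slice _) hp

theorem IsSmoothSection.dPrimeRaw [IsManifold (𝓡 n) ∞ M] {w : Fin m → RawForm n M 1}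
    (hw : ∀ k, IsSmoothForm (w k)) {f : RawSection n m M q} (hf : IsSmoothSection f) :
    IsSmoothSection (dPrimeRaw w f) := by
  intro t₀
  refine ContDiffOn.congr (f := fun p => extDeriv (fun y => sectionRep t₀ f (y, p.2)) p.1 +
        ∑ k, wedgeOne (chartRep t₀ (w k) p.1) (fderiv ℝ (sectionRep t₀ f) p (0, Pi.single k 1)))
    ?_ fun p hp => sectionRep_dPrimeRaw w hf t₀ hp.1
  refine (hf.contDiffOn_extDeriv t₀).add (ContDiffOn.sum fun k _ => contDiff_wedgeOne ?_ ?_)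
  · exact (hw k t₀).comp contDiffOn_fst fun p hp => hp.1
  · exact ((hf t₀).fderiv_of_isOpen (isOpen_target_prod t₀) (by simp)).clm_apply contDiffOn_const

theorem section_ext [IsManifold (𝓡 n) ∞ M] {f g : RawSection n m M q}
    (h : ∀ t₀ p, p.1 ∈ (extChartAt (𝓡 n) t₀).target → sectionRep t₀ f p = sectionRep t₀ g p) :
    f = g := by
  funext ⟨t, x⟩
  obtain ⟨x, rfl⟩ := torusMk_surjective x
  have h1 := h t (extChartAt (𝓡 n) t t, x) (mem_extChartAt_target t)
  obtain ⟨L, hL⟩ : ∃ L : EuclideanSpace ℝ (Fin n) ≃L[ℝ] EuclideanSpace ℝ (Fin n),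
      (L : EuclideanSpace ℝ (Fin n) →L[ℝ] EuclideanSpace ℝ (Fin n)) =
        mfderiv (𝓡 n) (𝓡 n) (extChartAt (𝓡 n) t).symm (extChartAt (𝓡 n) t t) :=
    isInvertible_mfderiv_symm t (mem_extChartAt_target t)
  have key : ∀ t' : M, t' = t →
      (show EuclideanSpace ℝ (Fin n) [⋀^Fin q]→L[ℝ] ℂ from f (t', torusMk x)).compContinuousLinearMap
        (L : EuclideanSpace ℝ (Fin n) →L[ℝ] EuclideanSpace ℝ (Fin n)) =
      (show EuclideanSpace ℝ (Fin n) [⋀^Fin q]→L[ℝ] ℂ from g (t', torusMk x)).compContinuousLinearMap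
        (L : EuclideanSpace ℝ (Fin n) →L[ℝ] EuclideanSpace ℝ (Fin n)) →
      f (t, torusMk x) = g (t, torusMk x) := by
    rintro t' rfl h2
    exact (L.symm.continuousAlternatingMapCongrLeft (ι := Fin q) (F := ℂ)).injective h2
  refine key _ (extChartAt_to_inv (I := 𝓡 n) t) ?_
  rw [hL]
  exact h1

theorem wedgeOne_add (α : EuclideanSpace ℝ (Fin n) [⋀^Fin 1]→L[ℝ] ℂ)
    (f g : EuclideanSpace ℝ (Fin n) [⋀^Fin q]→L[ℝ] ℂ) :
    wedgeOne α (f + g) = wedgeOne α f + wedgeOne α g := by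
  ext v
  simp [wedgeOne_apply, mul_add, Finset.sum_add_distrib]

theorem wedgeOne_smul (α : EuclideanSpace ℝ (Fin n) [⋀^Fin 1]→L[ℝ] ℂ) (c : ℂ)
    (f : EuclideanSpace ℝ (Fin n) [⋀^Fin q]→L[ℝ] ℂ) :
    wedgeOne α (c • f) = c • wedgeOne α f := by
  ext v
  simp only [wedgeOne_apply, ContinuousAlternatingMap.smul_apply, smul_eq_mul, Finset.mul_sum]
  exact Finset.sum_congr rfl fun i _ => by ring

theorem extDeriv_const_smul (c : ℂ)
    {f : EuclideanSpace ℝ (Fin n) → EuclideanSpace ℝ (Fin n) [⋀^Fin q]→L[ℝ] ℂ}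
    {y : EuclideanSpace ℝ (Fin n)} (hf : DifferentiableAt ℝ f y) :
    extDeriv (fun y => c • f y) y = c • extDeriv f y := by
  rw [extDeriv, fderiv_fun_const_smul hf, ContinuousAlternatingMap.alternatizeUncurryFin_smul]
  rfl

theorem dPrimeRaw_add [IsManifold (𝓡 n) ∞ M] (w : Fin m → RawForm n M 1)
    {f g : RawSection n m M q} (hf : IsSmoothSection f) (hg : IsSmoothSection g) :
    dPrimeRaw w (f + g) = dPrimeRaw w f + dPrimeRaw w g := by
  refine section_ext fun t₀ p hp => ?_
  have h0 : sectionRep t₀ (dPrimeRaw w f + dPrimeRaw w g) p =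
    sectionRep t₀ (dPrimeRaw w f) p + sectionRep t₀ (dPrimeRaw w g) p := rfl
  have h1 : sectionRep t₀ (f + g) = sectionRep t₀ f + sectionRep t₀ g := rfl
  have hdf := (hf.contDiffAt t₀ hp).differentiableAt (by simp)
  have hdg := (hg.contDiffAt t₀ hp).differentiableAt (by simp)
  rw [h0, sectionRep_dPrimeRaw w (hf.add hg) t₀ hp, sectionRep_dPrimeRaw w hf t₀ hp,
    sectionRep_dPrimeRaw w hg t₀ hp, h1, fderiv_add hdf hdg]
  simp only [add_apply, wedgeOne_add, Finset.sum_add_distrib, Pi.add_apply]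
  rw [extDeriv_fun_add (hf.differentiableAt_left t₀ hp) (hg.differentiableAt_left t₀ hp)]
  abel

theorem dPrimeRaw_smul [IsManifold (𝓡 n) ∞ M] (w : Fin m → RawForm n M 1) (c : ℂ)
    {f : RawSection n m M q} (hf : IsSmoothSection f) :
    dPrimeRaw w (c • f) = c • dPrimeRaw w f := by
  refine section_ext fun t₀ p hp => ?_
  have h0 : sectionRep t₀ (c • dPrimeRaw w f) p = c • sectionRep t₀ (dPrimeRaw w f) p := rfl
  have h1 : sectionRep t₀ (c • f) = c • sectionRep t₀ f := rfl
  have hdf := (hf.contDiffAt t₀ hp).differentiableAt (by simp)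
  rw [h0, sectionRep_dPrimeRaw w (hf.smul c) t₀ hp, sectionRep_dPrimeRaw w hf t₀ hp,
    h1, fderiv_const_smul hdf]
  simp only [smul_apply, wedgeOne_smul, Pi.smul_apply, smul_add,
    Finset.smul_sum]
  rw [extDeriv_const_smul c (hf.differentiableAt_left t₀ hp)]

theorem IsSmoothForm.extD [IsManifold (𝓡 n) ∞ M] {f : RawForm n M q} (hf : IsSmoothForm f) :
    IsSmoothForm (extD f) := by
  intro t₀
  refine ContDiffOn.congr (f := extDeriv (chartRep t₀ f)) ?_ fun y hy => chartRep_extD t₀ hf hy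
  exact (ContinuousAlternatingMap.alternatizeUncurryFinCLM ℝ
    (EuclideanSpace ℝ (Fin n)) ℂ).contDiff.comp_contDiffOn
      ((hf t₀).fderiv_of_isOpen (m := ∞) (isOpen_extChartAt_target t₀) (by simp))

theorem IsSmoothForm.wedge {w : RawForm n M 1} {f : RawForm n M q} (hw : IsSmoothForm w)
    (hf : IsSmoothForm f) : IsSmoothForm (wedge w f) := fun t₀ =>
  (contDiff_wedgeOne (hw t₀) (hf t₀)).congr fun y _ => chartRep_wedge t₀ w f y

theorem extD_add {f g : RawForm n M q} (hf : IsSmoothForm f) (hg : IsSmoothForm g) :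
    extD (f + g) = extD f + extD g := by
  funext t
  have h := extDeriv_add (hf.differentiableAt t (mem_extChartAt_target t))
    (hg.differentiableAt t (mem_extChartAt_target t))
  simp only [extD, chartRep_add, h]
  rfl

theorem extD_smul (c : ℂ) {f : RawForm n M q} (hf : IsSmoothForm f) :
    extD (c • f) = c • extD f := by
  funext t
  have h := extDeriv_const_smul c (hf.differentiableAt t (mem_extChartAt_target t))
  have h' : extDeriv (c • chartRep t f) (extChartAt (𝓡 n) t t) = _ := h
  simp only [extD, chartRep_smul, h']
  rfl

theorem wedge_add (w : RawForm n M 1) (f g : RawForm n M q) :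
    wedge w (f + g) = wedge w f + wedge w g :=
  funext fun t => wedgeOne_add (w t) (f t) (g t)

theorem wedge_smul (w : RawForm n M 1) (c : ℂ) (f : RawForm n M q) :
    wedge w (c • f) = c • wedge w f :=
  funext fun t => wedgeOne_smul (w t) c (f t)

theorem IsSmoothForm.embedRaw (ξ : Fin m → ℤ) {f : RawForm n M q} (hf : IsSmoothForm f) :
    IsSmoothSection (embedRaw ξ f) := by
  intro t₀
  have h : ContDiffOn ℝ ∞ (fun p : EuclideanSpace ℝ (Fin n) × (Fin m → ℝ) =>
      (((2 * Real.pi : ℂ) ^ m)⁻¹ * Complex.exp (Complex.I * ∑ k, (p.2 k : ℂ) * (ξ k : ℂ))) •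
        chartRep t₀ f p.1) ((extChartAt (𝓡 n) t₀).target ×ˢ Set.univ) := by
    have hk : ∀ k : Fin m, ContDiff ℝ ∞
        (fun p : EuclideanSpace ℝ (Fin n) × (Fin m → ℝ) => (p.2 k : ℂ)) := fun k =>
      Complex.ofRealCLM.contDiff.comp ((contDiff_apply ℝ ℝ k).comp contDiff_snd)
    have hA : ContDiff ℝ ∞ (fun p : EuclideanSpace ℝ (Fin n) × (Fin m → ℝ) =>
        ((2 * Real.pi : ℂ) ^ m)⁻¹ * Complex.exp (Complex.I * ∑ k, (p.2 k : ℂ) * (ξ k : ℂ))) :=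
      contDiff_const.mul (Complex.contDiff_exp.comp
        (contDiff_const.mul (ContDiff.sum fun k _ => (hk k).mul contDiff_const)))
    have hB : ContDiffOn ℝ ∞ (fun p : EuclideanSpace ℝ (Fin n) × (Fin m → ℝ) =>
        chartRep t₀ f p.1) ((extChartAt (𝓡 n) t₀).target ×ˢ Set.univ) :=
      (hf t₀).comp contDiffOn_fst fun _ hp => hp.1
    exact hA.contDiffOn.smul hB
  refine h.congr fun p _ => ?_
  rw [← torusChar_torusMk]
  rfl

/-! ### The spaces, the complexes and their cohomology -/

variable (n M) in
/-- `C^∞(M; Λ^q)`: smooth complex `q`-forms on `M`. -/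
def smoothForms (q : ℕ) : Submodule ℂ (RawForm n M q) where
  carrier := {f | IsSmoothForm f}
  add_mem' hf hg := fun t₀ => (hf t₀).add (hg t₀)
  zero_mem' := fun _ => contDiffOn_const (c := (0 : EuclideanSpace ℝ (Fin n) [⋀^Fin q]→L[ℝ] ℂ))
  smul_mem' c _ hf := fun t₀ => (hf t₀).const_smul c

variable (n m M) in
/-- `C^∞(M × 𝕋^m; Λ^q)`: smooth sections over `M × 𝕋^m` of the pullback of the bundle of complex
`q`-forms on `M`. -/
def smoothSections (q : ℕ) : Submodule ℂ (RawSection n m M q) where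
  carrier := {f | IsSmoothSection f}
  add_mem' hf hg := hf.add hg
  zero_mem' := isSmoothSection_zero
  smul_mem' c _ hf := hf.smul c

variable (n M) in
/-- The type of smooth complex `q`-forms on `M`. -/
def SmoothForm (q : ℕ) : Type _ := smoothForms n M q

instance (q : ℕ) : AddCommGroup (SmoothForm n M q) := inferInstanceAs (AddCommGroup (smoothForms n M q))

instance (q : ℕ) : Module ℂ (SmoothForm n M q) := inferInstanceAs (Module ℂ (smoothForms n M q))

variable (n m M) in
/-- The type of smooth sections over `M × 𝕋^m` of the pullback of the bundle of complex
`q`-forms on `M`. -/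
def SmoothSection (q : ℕ) : Type _ := smoothSections n m M q

instance (q : ℕ) : AddCommGroup (SmoothSection n m M q) :=
  inferInstanceAs (AddCommGroup (smoothSections n m M q))

instance (q : ℕ) : Module ℂ (SmoothSection n m M q) :=
  inferInstanceAs (Module ℂ (smoothSections n m M q))

/-- The map `E_ξ : C^∞(M; Λ^q) → C^∞(M × 𝕋^m; Λ^q)`, `f ↦ (2π)^{-m} e^{i x ξ} f`. -/
def embed (ξ : Fin m → ℤ) (q : ℕ) : SmoothForm n M q →ₗ[ℂ] SmoothSection n m M q where
  toFun f := ⟨embedRaw ξ f.1, IsSmoothForm.embedRaw ξ f.2⟩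
  map_add' f g := Subtype.ext (funext fun p => smul_add _ (f.1 p.1) (g.1 p.1))
  map_smul' c f := Subtype.ext (funext fun p => smul_comm _ c (f.1 p.1))

/-- Exterior product with a fixed smooth `1`-form. -/
def wedgeForm (w : SmoothForm n M 1) (q : ℕ) :
    SmoothForm n M q →ₗ[ℂ] SmoothForm n M (q + 1) where
  toFun f := ⟨wedge w.1 f.1, IsSmoothForm.wedge w.2 f.2⟩
  map_add' f g := Subtype.ext (wedge_add w.1 f.1 g.1)
  map_smul' c f := Subtype.ext (wedge_smul w.1 c f.1)

variable [IsManifold (𝓡 n) ∞ M]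

/-- The exterior derivative `d : C^∞(M; Λ^q) → C^∞(M; Λ^{q+1})`. -/
def dForm (q : ℕ) : SmoothForm n M q →ₗ[ℂ] SmoothForm n M (q + 1) where
  toFun f := ⟨extD f.1, IsSmoothForm.extD f.2⟩
  map_add' f g := Subtype.ext (extD_add f.2 g.2)
  map_smul' c f := Subtype.ext (extD_smul c f.2)

/-- `d'_ξ f = d f + i (ξ · w) ∧ f`, where `ξ · w = ∑ k, ξ_k w_k`. -/
def dXi (w : Fin m → SmoothForm n M 1) (ξ : Fin m → ℤ) (q : ℕ) :
    SmoothForm n M q →ₗ[ℂ] SmoothForm n M (q + 1) :=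
  dForm q + Complex.I • wedgeForm (∑ k, (ξ k : ℂ) • w k) q

/-- `d' = d_t + ∑ k, w_k ∧ ∂/∂x_k : C^∞(M × 𝕋^m; Λ^q) → C^∞(M × 𝕋^m; Λ^{q+1})`. -/
def dPrime (w : Fin m → SmoothForm n M 1) (q : ℕ) :
    SmoothSection n m M q →ₗ[ℂ] SmoothSection n m M (q + 1) where
  toFun f := ⟨dPrimeRaw (fun k => (w k).1) f.1, IsSmoothSection.dPrimeRaw (fun k => (w k).2) f.2⟩
  map_add' f g := Subtype.ext (dPrimeRaw_add _ f.2 g.2)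
  map_smul' c f := Subtype.ext (dPrimeRaw_smul _ c f.2)

end Manifold

section Cohomology

variable {A : ℕ → Type*} [∀ q, AddCommGroup (A q)] [∀ q, Module ℂ (A q)]

/-- The range of the differential arriving in degree `q` (zero in degree `0`). -/
def coboundaries (d : ∀ q, A q →ₗ[ℂ] A (q + 1)) : (q : ℕ) → Submodule ℂ (A q)
  | 0 => ⊥
  | q + 1 => LinearMap.range (d q)

/-- The cohomology `ker d_q / ran d_{q-1}` of a complex of complex vector spaces. The range is
viewed as a subspace of the kernel; it lies in the kernel because `d ∘ d = 0`. -/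
abbrev Cohomology (d : ∀ q, A q →ₗ[ℂ] A (q + 1)) (q : ℕ) : Type _ :=
  LinearMap.ker (d q) ⧸ (coboundaries d q).submoduleOf (LinearMap.ker (d q))

/-- The cohomology class of a cocycle. -/
abbrev Cohomology.mk (d : ∀ q, A q →ₗ[ℂ] A (q + 1)) (q : ℕ) :
    LinearMap.ker (d q) →ₗ[ℂ] Cohomology d q :=
  Submodule.mkQ _

end Cohomology

section TubeCohomology

variable {n m : ℕ} {M : Type*} [TopologicalSpace M] [ChartedSpace (EuclideanSpace ℝ (Fin n)) M]
  [IsManifold (𝓡 n) ∞ M]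

/-- `H^q_ξ(C^∞(M))`, the cohomology of the complex `d'_ξ`. -/
abbrev HXi (w : Fin m → SmoothForm n M 1) (ξ : Fin m → ℤ) (q : ℕ) : Type _ :=
  Cohomology (A := SmoothForm n M) (dXi w ξ) q

/-- `H^q_{d'}(C^∞(M × 𝕋^m))`, the cohomology of the complex `d'`. -/
abbrev HPrime (w : Fin m → SmoothForm n M 1) (q : ℕ) : Type _ :=
  Cohomology (A := SmoothSection n m M) (dPrime w) q


end TubeCohomology

end TubeStructure

end

/-!
The maps induced by `E_ξ` in cohomology have left inverses given by Fourier coefficients. For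
`ξ ∈ ℤ^m` let `F_ξ f = ∫ e^{-i x ξ} f(·, x) dx`, a map from sections over `M × 𝕋^m` to forms on `M`
(`fourierCoeffMap`). Then

* `E_ξ` is a chain map from `d'_ξ` to `d'` (`embed_dXi`),
* `F_ξ` is a chain map from `d'` to `d'_ξ` (`fourierCoeffMap_dPrime`),
* `F_ξ E_ξ` is the identity, and `F_η E_ξ = 0` for `ξ ≠ η`, by orthogonality of the characters
  (`fourierCoeffMap_embed`).

In cohomology the same relations hold, and they give the injectivity of each `[E_ξ]` and of the map
on the direct sum (`injective_toModule_of_dual`).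

Both chain map properties come from the conjugation formula
`d' (e^{ixη} f) = e^{ixη} (d' f + i (η · w) ∧ f)` (`dPrimeRaw_charMul`), which reduces them to
frequency zero: `d'` of the pullback of a form on `M` is the pullback of its exterior derivative, and
integration along the torus commutes with `d_t` and `w ∧ ·` and annihilates `∂/∂x_k`
(`average_dPrimeRaw`). The analytic input is differentiation under the integral over the compact
torus (`hasFDerivAt_integral_torus`), which also shows that `F_ξ f` is smooth
(`contDiffOn_integral_torus`); the vanishing of integrals of partial derivatives follows from it by
invariance of the measure (`integral_deriv_torus`).
-/

noncomputable section

namespace TubeStructure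

open MeasureTheory

/-! ### Integration over the torus of functions with parameters -/

instance : Fact (0 < 2 * Real.pi) := ⟨Real.two_pi_pos⟩

section Average

variable {m : ℕ}

theorem isOpenQuotientMap_torusMk : IsOpenQuotientMap (torusMk (m := m)) :=
  IsOpenQuotientMap.piMap fun _ => QuotientAddGroup.isOpenQuotientMap_mk

/-- Differentiation under the integral over a compact space, for an integrand whose derivative is
jointly continuous. -/
theorem hasFDerivAt_integral_of_compactSpace {X : Type*} [TopologicalSpace X] [CompactSpace X]
    [SecondCountableTopology X] [MeasurableSpace X] [BorelSpace X] {μ : Measure X}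
    [IsFiniteMeasure μ] {E V : Type*} [NormedAddCommGroup E] [NormedSpace ℝ E]
    [NormedAddCommGroup V] [NormedSpace ℝ V] {F : E → X → V} {F' : E → X → E →L[ℝ] V} {U : Set E}
    (hU : IsOpen U) (hF : ContinuousOn (Function.uncurry F) (U ×ˢ Set.univ))
    (hF' : ContinuousOn (Function.uncurry F') (U ×ˢ Set.univ))
    (hd : ∀ y ∈ U, ∀ x, HasFDerivAt (fun z => F z x) (F' y x) y) {y : E} (hy : y ∈ U) :
    HasFDerivAt (fun z => ∫ x, F z x ∂μ) (∫ x, F' y x ∂μ) y := by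
  have hc : ∀ z ∈ U, Continuous (F z) := fun z hz =>
    hF.comp_continuous (Continuous.prodMk_right z) fun x => ⟨hz, trivial⟩
  have hc' : Continuous (F' y) :=
    hF'.comp_continuous (Continuous.prodMk_right y) fun x => ⟨hy, trivial⟩
  have hint : ∀ z ∈ U, Integrable (F z) μ := fun z hz =>
    (hc z hz).integrable_of_hasCompactSupport (HasCompactSupport.of_compactSpace _)
  have hint' : Integrable (F' y) μ :=
    hc'.integrable_of_hasCompactSupport (HasCompactSupport.of_compactSpace _)
  -- compactness of `X` gives a bound of the derivative that is uniform near `y`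
  obtain ⟨C, hC⟩ := (isCompact_range hc').isBounded.exists_norm_le
  have hbd : ∀ᶠ z in 𝓝 y, ∀ x ∈ (Set.univ : Set X), ‖F' z x‖ < C + 1 := by
    refine isCompact_univ.eventually_forall_of_forall_eventually fun x _ => ?_
    have h1 : ContinuousAt (Function.uncurry F') (y, x) :=
      hF'.continuousAt ((hU.prod isOpen_univ).mem_nhds ⟨hy, trivial⟩)
    exact h1.norm.eventually_lt continuousAt_const
      ((hC _ ⟨x, rfl⟩).trans_lt (lt_add_one C))
  refine hasFDerivAt_integral_of_dominated_of_fderiv_le (hbd.and (hU.mem_nhds hy))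
    (bound := fun _ => C + 1) ?_ (hint y hy) hint'.aestronglyMeasurable
    (Filter.Eventually.of_forall fun x z hz => (hz.1 x trivial).le) (integrable_const _)
    (Filter.Eventually.of_forall fun x z hz => hd z hz.2 x)
  filter_upwards [hU.mem_nhds hy] with z hz using (hint z hz).aestronglyMeasurable

/-- Continuity on `U × 𝕋^m` may be tested in the coordinates `x ∈ ℝ^m`, because `torusMk` is an open
quotient map. -/
theorem continuousOn_uncurry_of_torusMk {E V : Type*} [TopologicalSpace E] [TopologicalSpace V]
    {U : Set E} {g : E → Torus m → V} (hU : IsOpen U)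
    (hg : ContinuousOn (fun p : E × (Fin m → ℝ) => g p.1 (torusMk p.2)) (U ×ˢ Set.univ)) :
    ContinuousOn (Function.uncurry g) (U ×ˢ Set.univ) := by
  rintro ⟨y, x⟩ ⟨hy, -⟩
  obtain ⟨x, rfl⟩ := isOpenQuotientMap_torusMk.surjective x
  have hq : IsOpenQuotientMap (Prod.map id torusMk : E × (Fin m → ℝ) → E × Torus m) :=
    IsOpenQuotientMap.id.prodMap isOpenQuotientMap_torusMk
  have h1 : ContinuousAt (Function.uncurry g ∘ Prod.map id torusMk) (y, x) :=
    hg.continuousAt ((hU.prod isOpen_univ).mem_nhds ⟨hy, trivial⟩)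
  exact (hq.continuousAt_comp_iff.1 h1).continuousWithinAt

theorem integrable_torus {E V : Type*} [TopologicalSpace E] [NormedAddCommGroup V]
    {U : Set E} {g : E → Torus m → V} (hU : IsOpen U)
    (hg : ContinuousOn (fun p : E × (Fin m → ℝ) => g p.1 (torusMk p.2)) (U ×ˢ Set.univ))
    {y : E} (hy : y ∈ U) : Integrable (g y) :=
  Continuous.integrable_of_hasCompactSupport
    ((continuousOn_uncurry_of_torusMk hU hg).comp_continuous (Continuous.prodMk_right y)
      fun _ => ⟨hy, trivial⟩) (HasCompactSupport.of_compactSpace _)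

variable {E V : Type*} [NormedAddCommGroup E] [NormedSpace ℝ E]
  [NormedAddCommGroup V] [NormedSpace ℝ V] {U : Set E} {g : E → Torus m → V}

/-- The derivative in the first variable of a function of class `C^(r+1)` on `U × 𝕋^m` is of
class `C^r`. -/
theorem contDiffOn_fderiv_left {r : ℕ∞ω} (hU : IsOpen U)
    (hg : ContDiffOn ℝ (r + 1) (fun p : E × (Fin m → ℝ) => g p.1 (torusMk p.2))
      (U ×ˢ Set.univ)) :
    ContDiffOn ℝ r (fun p : E × (Fin m → ℝ) => fderiv ℝ (fun z => g z (torusMk p.2)) p.1)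
      (U ×ˢ Set.univ) := by
  have hO := hU.prod (isOpen_univ (X := Fin m → ℝ))
  have h1 := hg.fderiv_of_isOpen hO le_rfl
  refine (h1.clm_comp (contDiffOn_const (c := ContinuousLinearMap.inl ℝ E (Fin m → ℝ)))).congr ?_
  rintro ⟨y, x⟩ hp
  have hd := ((hg.differentiableOn (by simp)).differentiableAt (hO.mem_nhds hp)).hasFDerivAt
  exact (hd.comp y (hasFDerivAt_prodMk_left (𝕜 := ℝ) y x)).fderiv

theorem hasFDerivAt_fderiv_left {r : ℕ∞ω} (hr : r ≠ 0) (hU : IsOpen U)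
    (hg : ContDiffOn ℝ r (fun p : E × (Fin m → ℝ) => g p.1 (torusMk p.2)) (U ×ˢ Set.univ))
    {y : E} (hy : y ∈ U) (x : Torus m) :
    HasFDerivAt (fun z => g z x) (fderiv ℝ (fun z => g z x) y) y := by
  obtain ⟨x, rfl⟩ := isOpenQuotientMap_torusMk.surjective x
  have hd := ((hg.differentiableOn hr).differentiableAt
    ((hU.prod (isOpen_univ (X := Fin m → ℝ))).mem_nhds ⟨hy, trivial⟩ : _ ∈ 𝓝 (y, x)))
  exact (hd.hasFDerivAt.comp y (hasFDerivAt_prodMk_left (𝕜 := ℝ) y x)).differentiableAt.hasFDerivAt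

theorem hasFDerivAt_integral_torus (hU : IsOpen U)
    (hg : ContDiffOn ℝ 1 (fun p : E × (Fin m → ℝ) => g p.1 (torusMk p.2)) (U ×ˢ Set.univ))
    {y : E} (hy : y ∈ U) :
    HasFDerivAt (fun z => ∫ x, g z x) (∫ x, fderiv ℝ (fun z => g z x) y) y :=
  hasFDerivAt_integral_of_compactSpace hU
    (continuousOn_uncurry_of_torusMk hU hg.continuousOn)
    (continuousOn_uncurry_of_torusMk (g := fun y x => fderiv ℝ (fun z => g z x) y) hU
      (contDiffOn_fderiv_left (r := 0) hU (by simpa using hg)).continuousOn)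
    (fun _ hz x => hasFDerivAt_fderiv_left one_ne_zero hU hg hz x) hy

universe u

/-- One order of differentiability is given away, so that continuity and differentiability under the
integral both come from `hasFDerivAt_integral_torus`. -/
theorem contDiffOn_integral_torus_nat {E : Type u} [NormedAddCommGroup E] [NormedSpace ℝ E]
    {U : Set E} (hU : IsOpen U) (r : ℕ) :
    ∀ {V : Type u} [NormedAddCommGroup V] [NormedSpace ℝ V] {g : E → Torus m → V},
      ContDiffOn ℝ (r + 1) (fun p : E × (Fin m → ℝ) => g p.1 (torusMk p.2)) (U ×ˢ Set.univ) →
      ContDiffOn ℝ r (fun y => ∫ x, g y x) U := by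
  induction r with
  | zero =>
    intro V _ _ g hg
    refine contDiffOn_zero.2 fun y hy => ?_
    exact (hasFDerivAt_integral_torus hU (by simpa using hg) hy).continuousAt.continuousWithinAt
  | succ r ih =>
    intro V _ _ g hg
    have hd := fun y hy => hasFDerivAt_integral_torus hU
      (hg.of_le (by simp)) (y := y) hy
    push_cast
    refine (contDiffOn_succ_iff_fderiv_of_isOpen hU).2
      ⟨fun y hy => (hd y hy).differentiableAt.differentiableWithinAt, by simp, ?_⟩
    refine (ih (g := fun y x => fderiv ℝ (fun z => g z x) y) ?_).congr fun y hy => (hd y hy).fderiv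
    exact contDiffOn_fderiv_left hU (by exact_mod_cast hg)

theorem contDiffOn_integral_torus {E V : Type u} [NormedAddCommGroup E] [NormedSpace ℝ E]
    [NormedAddCommGroup V] [NormedSpace ℝ V] {U : Set E} {g : E → Torus m → V} (hU : IsOpen U)
    (hg : ContDiffOn ℝ ∞ (fun p : E × (Fin m → ℝ) => g p.1 (torusMk p.2)) (U ×ˢ Set.univ)) :
    ContDiffOn ℝ ∞ (fun y => ∫ x, g y x) U :=
  contDiffOn_infty.2 fun r => contDiffOn_integral_torus_nat hU r
    (hg.of_le (by exact_mod_cast le_top))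

/-- The integral over the torus of a partial derivative vanishes: by invariance of the measure,
the integral of a translate does not depend on the translation. -/
theorem integral_deriv_torus {V : Type*} [NormedAddCommGroup V] [NormedSpace ℝ V] [CompleteSpace V]
    {h : Torus m → V} (hh : ContDiff ℝ 1 fun x : Fin m → ℝ => h (torusMk x)) (k : Fin m) :
    ∫ x, deriv (fun s : ℝ => h (x + (Pi.single k (s : AddCircle (2 * Real.pi)) : Torus m))) 0 = 0 := by
  have hg : ContDiffOn ℝ 1 (fun p : ℝ × (Fin m → ℝ) =>
      h (torusMk p.2 + (Pi.single k (p.1 : AddCircle (2 * Real.pi)) : Torus m))) (Set.univ ×ˢ Set.univ) := by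
    simp_rw [torusMk_add_single]
    exact (hh.comp (contDiff_snd.add (contDiff_fst.smul contDiff_const))).contDiffOn
  have hi : Integrable fun x : Torus m => fderiv ℝ
      (fun s : ℝ => h (x + (Pi.single k (s : AddCircle (2 * Real.pi)) : Torus m))) 0 :=
    integrable_torus (E := ℝ) (g := fun s x => fderiv ℝ (fun s : ℝ => h (x +
      (Pi.single k (s : AddCircle (2 * Real.pi)) : Torus m))) s) isOpen_univ (contDiffOn_fderiv_left (r := 0)
      (g := fun (s : ℝ) x => h (x + (Pi.single k (s : AddCircle (2 * Real.pi)) : Torus m)))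
      isOpen_univ (by simpa using hg)).continuousOn trivial
  have h1 := hasFDerivAt_integral_torus
    (g := fun (s : ℝ) x => h (x + (Pi.single k (s : AddCircle (2 * Real.pi)) : Torus m)))
    isOpen_univ hg (Set.mem_univ 0)
  simp_rw [integral_add_right_eq_self h] at h1
  have h2 := congrArg (fun A : ℝ →L[ℝ] V => A 1) (h1.unique (hasFDerivAt_const _ _))
  rw [ContinuousLinearMap.integral_apply hi] at h2
  simp only [fderiv_apply_one_eq_deriv] at h2
  exact h2

end Average

/-! ### Characters of the torus -/

section Characters

variable {m : ℕ}

theorem torusChar_add (ξ η : Fin m → ℤ) (x : Torus m) :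
    torusChar (ξ + η) x = torusChar ξ x * torusChar η x := by
  simp [torusChar, Finset.prod_mul_distrib]

theorem torusChar_zero (x : Torus m) : torusChar 0 x = 1 := by
  simp [torusChar]

theorem integral_fourier_addCircle {T : ℝ} [hT : Fact (0 < T)] (k : ℤ) :
    ∫ x : AddCircle T, fourier k x = if k = 0 then (T : ℂ) else 0 := by
  split_ifs with h
  · simp [h, Measure.real, hT.out.le]
  -- a translation by `T / (2 k)` changes the sign of the character
  · exact integral_eq_zero_of_add_right_eq_neg (μ := volume)
      (fourier_add_half_inv_index h hT.out)

theorem integral_torusChar (ξ : Fin m → ℤ) :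
    ∫ x, torusChar ξ x = if ξ = 0 then (2 * Real.pi : ℂ) ^ m else 0 := by
  simp only [torusChar]
  rw [integral_fintype_prod_volume_eq_prod (fun k (x : AddCircle (2 * Real.pi)) => fourier (ξ k) x)]
  simp_rw [integral_fourier_addCircle]
  split_ifs with h
  · simp [h]
  · obtain ⟨k, hk⟩ := Function.ne_iff.1 h
    exact Finset.prod_eq_zero (Finset.mem_univ k) (by simpa using hk)

end Characters

section Manifold

variable {n m : ℕ} {M : Type*} [TopologicalSpace M] [ChartedSpace (EuclideanSpace ℝ (Fin n)) M]
  {q : ℕ}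

/-! ### Operations on sections -/

/-- The exterior product `f ↦ α ∧ f` with a covector, as a continuous linear map; it is equal to
`wedgeOne α` by definition. -/
def wedgeOneCLM (α : EuclideanSpace ℝ (Fin n) [⋀^Fin 1]→L[ℝ] ℂ) :
    (EuclideanSpace ℝ (Fin n) [⋀^Fin q]→L[ℝ] ℂ) →L[ℝ]
      EuclideanSpace ℝ (Fin n) [⋀^Fin (q + 1)]→L[ℝ] ℂ :=
  (ContinuousAlternatingMap.alternatizeUncurryFinCLM ℝ (EuclideanSpace ℝ (Fin n)) ℂ).comp
    (((ContinuousLinearMap.compL ℝ (EuclideanSpace ℝ (Fin n)) ℂ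
      (EuclideanSpace ℝ (Fin n) [⋀^Fin q]→L[ℝ] ℂ)).flip
        ((ContinuousAlternatingMap.ofSubsingleton ℝ (EuclideanSpace ℝ (Fin n)) ℂ
          (0 : Fin 1)).symm α)).comp (ContinuousLinearMap.lsmul ℝ ℂ).flip)

theorem wedgeOne_sum_smul_left {ι : Type*} (s : Finset ι) (c : ι → ℂ)
    (α : ι → EuclideanSpace ℝ (Fin n) [⋀^Fin 1]→L[ℝ] ℂ)
    (f : EuclideanSpace ℝ (Fin n) [⋀^Fin q]→L[ℝ] ℂ) :
    wedgeOne (∑ k ∈ s, c k • α k) f = ∑ k ∈ s, c k • wedgeOne (α k) f := by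
  ext v
  simp only [wedgeOne_apply, ContinuousAlternatingMap.sum_apply,
    ContinuousAlternatingMap.smul_apply, smul_eq_mul, Finset.mul_sum, Finset.sum_mul]
  rw [Finset.sum_comm]
  exact Finset.sum_congr rfl fun k _ => Finset.sum_congr rfl fun i _ => by ring

/-- Multiplication of a section by the character `e^{i x η}` of the torus. -/
def charMul (η : Fin m → ℤ) (f : RawSection n m M q) : RawSection n m M q := fun p =>
  torusChar η p.2 • f p

theorem sectionRep_charMul (t₀ : M) (η : Fin m → ℤ) (f : RawSection n m M q)
    (p : EuclideanSpace ℝ (Fin n) × (Fin m → ℝ)) :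
    sectionRep t₀ (charMul η f) p =
      Complex.exp (Complex.I * ∑ k, (p.2 k : ℂ) * (η k : ℂ)) • sectionRep t₀ f p := by
  rw [← torusChar_torusMk]
  rfl

theorem hasFDerivAt_exp_char (η : Fin m → ℤ) (x : Fin m → ℝ) :
    HasFDerivAt (fun x : Fin m → ℝ => Complex.exp (Complex.I * ∑ k, (x k : ℂ) * (η k : ℂ)))
      (Complex.exp (Complex.I * ∑ k, (x k : ℂ) * (η k : ℂ)) • Complex.I •
        ∑ k, (η k : ℂ) • Complex.ofRealCLM.comp (ContinuousLinearMap.proj k)) x := by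
  refine HasFDerivAt.cexp (HasFDerivAt.const_mul (HasFDerivAt.fun_sum fun k _ => ?_) _)
  exact (Complex.ofRealCLM.hasFDerivAt.comp x (hasFDerivAt_apply k x)).mul_const _

theorem contDiff_exp_char (η : Fin m → ℤ) : ContDiff ℝ ∞
    (fun x : Fin m → ℝ => Complex.exp (Complex.I * ∑ k, (x k : ℂ) * (η k : ℂ))) :=
  Complex.contDiff_exp.comp (contDiff_const.mul (ContDiff.sum fun k _ =>
    (Complex.ofRealCLM.contDiff.comp (contDiff_apply ℝ ℝ k)).mul contDiff_const))

theorem IsSmoothSection.charMul (η : Fin m → ℤ) {f : RawSection n m M q}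
    (hf : IsSmoothSection f) : IsSmoothSection (charMul η f) := fun t₀ =>
  (((contDiff_exp_char η).comp contDiff_snd).contDiffOn.smul (hf t₀)).congr
    fun p _ => sectionRep_charMul t₀ η f p

theorem form_ext [IsManifold (𝓡 n) ∞ M] {f g : RawForm n M q}
    (h : ∀ t₀ y, y ∈ (extChartAt (𝓡 n) t₀).target → chartRep t₀ f y = chartRep t₀ g y) :
    f = g := by
  -- a form is a section over the product with the torus of dimension `0`
  have h1 := section_ext (m := 0) (f := fun p => f p.1) (g := fun p => g p.1)
    fun t₀ p hp => h t₀ p.1 hp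
  exact funext fun t => congrFun h1 (t, 0)

/-- Exterior product of a section with a `1`-form of `M`. -/
def sectionWedge (w : RawForm n M 1) (f : RawSection n m M q) : RawSection n m M (q + 1) :=
  fun p => wedge w (slice f p.2) p.1

theorem sectionRep_sectionWedge (t₀ : M) (w : RawForm n M 1) (f : RawSection n m M q)
    (p : EuclideanSpace ℝ (Fin n) × (Fin m → ℝ)) :
    sectionRep t₀ (sectionWedge w f) p = wedgeOne (chartRep t₀ w p.1) (sectionRep t₀ f p) :=
  chartRep_wedge t₀ w _ p.1

theorem IsSmoothSection.sectionWedge {w : RawForm n M 1} (hw : IsSmoothForm w)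
    {f : RawSection n m M q} (hf : IsSmoothSection f) : IsSmoothSection (sectionWedge w f) :=
  fun t₀ => (contDiff_wedgeOne ((hw t₀).comp contDiffOn_fst fun _ hp => hp.1) (hf t₀)).congr
    fun p _ => sectionRep_sectionWedge t₀ w f p

theorem chartRep_sum_smul {ι : Type*} (t₀ : M) (s : Finset ι) (c : ι → ℂ)
    (f : ι → RawForm n M q) (y : EuclideanSpace ℝ (Fin n)) :
    chartRep t₀ (∑ k ∈ s, c k • f k) y = ∑ k ∈ s, c k • chartRep t₀ (f k) y := by
  classical
  induction s using Finset.induction_on with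
  | empty => rfl
  | insert a s ha ih =>
    rw [Finset.sum_insert ha, Finset.sum_insert ha, ← ih]
    rfl

/-- Conjugation of `d'` by a character: `d' (e^{ixη} f) = e^{ixη} (d' f + i (η · w) ∧ f)`. -/
theorem dPrimeRaw_charMul [IsManifold (𝓡 n) ∞ M] (w : Fin m → RawForm n M 1) (η : Fin m → ℤ)
    {f : RawSection n m M q} (hf : IsSmoothSection f) :
    dPrimeRaw w (charMul η f) =
      charMul η (dPrimeRaw w f + Complex.I • sectionWedge (∑ k, (η k : ℂ) • w k) f) := by
  refine section_ext fun t₀ p hp => ?_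
  have h0 : sectionRep t₀ (dPrimeRaw w f + Complex.I • sectionWedge (∑ k, (η k : ℂ) • w k) f) p =
      sectionRep t₀ (dPrimeRaw w f) p +
        Complex.I • sectionRep t₀ (sectionWedge (∑ k, (η k : ℂ) • w k) f) p := rfl
  rw [sectionRep_charMul, h0, sectionRep_dPrimeRaw w hf t₀ hp,
    sectionRep_dPrimeRaw w (hf.charMul η) t₀ hp, sectionRep_sectionWedge,
    chartRep_sum_smul, wedgeOne_sum_smul_left]
  have h1 : sectionRep t₀ (charMul η f) = fun p =>
    Complex.exp (Complex.I * ∑ k, (p.2 k : ℂ) * (η k : ℂ)) • sectionRep t₀ f p :=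
    funext fun p => sectionRep_charMul t₀ η f p
  have hd := ((hf.contDiffAt t₀ hp).differentiableAt (by simp)).hasFDerivAt
  have h2 := ((hasFDerivAt_exp_char η p.2).comp p hasFDerivAt_snd).smul hd
  have h3 : ∀ k, fderiv ℝ (sectionRep t₀ (charMul η f)) p (0, Pi.single k 1) =
      Complex.exp (Complex.I * ∑ k, (p.2 k : ℂ) * (η k : ℂ)) •
        (fderiv ℝ (sectionRep t₀ f) p (0, Pi.single k 1) +
          (Complex.I * η k) • sectionRep t₀ f p) := by
    intro k
    have h4 := congrArg (fun A : _ →L[ℝ] _ => A (0, Pi.single k 1)) h2.fderiv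
    rw [h1]
    refine Eq.trans h4 ?_
    simp [Pi.single_apply, apply_ite Complex.ofReal, smul_smul, mul_assoc]
  simp_rw [h3, wedgeOne_smul, wedgeOne_add, wedgeOne_smul]
  simp only [h1]
  rw [extDeriv_const_smul _ (hf.differentiableAt_left t₀ hp)]
  simp only [smul_add, Finset.smul_sum, Finset.sum_add_distrib, smul_smul, add_assoc]

/-! ### Averages of sections -/

/-- The integral of a section along the torus, for the measure of total mass `(2π)^m`. -/
def average (f : RawSection n m M q) : RawForm n M q := fun t =>
  (∫ x : Torus m, (f (t, x) : EuclideanSpace ℝ (Fin n) [⋀^Fin q]→L[ℝ] ℂ) :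
    EuclideanSpace ℝ (Fin n) [⋀^Fin q]→L[ℝ] ℂ)

theorem chartRep_average [IsManifold (𝓡 n) ∞ M] (t₀ : M) (f : RawSection n m M q)
    {y : EuclideanSpace ℝ (Fin n)} (hy : y ∈ (extChartAt (𝓡 n) t₀).target) :
    chartRep t₀ (average f) y = ∫ x : Torus m, chartRep t₀ (slice f x) y := by
  obtain ⟨L, hL⟩ : ∃ L : EuclideanSpace ℝ (Fin n) ≃L[ℝ] EuclideanSpace ℝ (Fin n),
      (L : EuclideanSpace ℝ (Fin n) →L[ℝ] EuclideanSpace ℝ (Fin n)) =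
        mfderiv (𝓡 n) (𝓡 n) (extChartAt (𝓡 n) t₀).symm y := isInvertible_mfderiv_symm t₀ hy
  have h := (L.symm.continuousAlternatingMapCongrLeft (ι := Fin q) (F := ℂ)).integral_comp_comm
    (μ := volume) (fun x : Torus m =>
      (f ((extChartAt (𝓡 n) t₀).symm y, x) : EuclideanSpace ℝ (Fin n) [⋀^Fin q]→L[ℝ] ℂ))
  simp only [chartRep]
  rw [← hL]
  exact h.symm

theorem IsSmoothSection.average [IsManifold (𝓡 n) ∞ M] {f : RawSection n m M q}
    (hf : IsSmoothSection f) : IsSmoothForm (average f) := fun t₀ =>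
  (contDiffOn_integral_torus (g := fun y x => chartRep t₀ (TubeStructure.slice f x) y)
    (isOpen_extChartAt_target t₀) (hf t₀)).congr
    fun _ hy => chartRep_average t₀ f hy

theorem IsSmoothSection.integrable {f : RawSection n m M q}
    (hf : IsSmoothSection f) (t₀ : M) {y : EuclideanSpace ℝ (Fin n)}
    (hy : y ∈ (extChartAt (𝓡 n) t₀).target) :
    Integrable fun x : Torus m => chartRep t₀ (TubeStructure.slice f x) y :=
  integrable_torus (g := fun y x => chartRep t₀ (TubeStructure.slice f x) y)
    (isOpen_extChartAt_target t₀) (hf t₀).continuousOn hy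

theorem average_add [IsManifold (𝓡 n) ∞ M] {f g : RawSection n m M q}
    (hf : IsSmoothSection f) (hg : IsSmoothSection g) :
    average (f + g) = average f + average g := by
  refine form_ext fun t₀ y hy => ?_
  rw [chartRep_add, Pi.add_apply, chartRep_average t₀ _ hy, chartRep_average t₀ _ hy,
    chartRep_average t₀ _ hy, ← integral_add (hf.integrable t₀ hy) (hg.integrable t₀ hy)]
  rfl

theorem average_smul (c : ℂ) (f : RawSection n m M q) : average (c • f) = c • average f :=
  funext fun t => integral_smul (μ := volume) c fun x : Torus m =>
    (show EuclideanSpace ℝ (Fin n) [⋀^Fin q]→L[ℝ] ℂ from f (t, x))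

theorem average_sectionWedge [IsManifold (𝓡 n) ∞ M] (w : RawForm n M 1) {f : RawSection n m M q}
    (hf : IsSmoothSection f) : average (sectionWedge w f) = wedge w (average f) := by
  refine form_ext fun t₀ y hy => ?_
  rw [chartRep_wedge, chartRep_average t₀ _ hy, chartRep_average t₀ _ hy]
  refine Eq.trans ?_ ((wedgeOneCLM (chartRep t₀ w y)).integral_comp_comm (hf.integrable t₀ hy))
  exact integral_congr_ae (Filter.Eventually.of_forall fun x => chartRep_wedge t₀ w _ y)

theorem IsSmoothSection.torusDeriv [IsManifold (𝓡 n) ∞ M] (k : Fin m) {f : RawSection n m M q}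
    (hf : IsSmoothSection f) : IsSmoothSection (torusDeriv k f) := fun t₀ =>
  (((hf t₀).fderiv_of_isOpen (isOpen_target_prod t₀) (by simp)).clm_apply contDiffOn_const).congr
    fun _ hp => chartRep_torusDeriv t₀ k hf hp.1

theorem average_torusDeriv [IsManifold (𝓡 n) ∞ M] (k : Fin m) {f : RawSection n m M q}
    (hf : IsSmoothSection f) : average (torusDeriv k f) = 0 := by
  refine form_ext fun t₀ y hy => ?_
  rw [chartRep_average t₀ _ hy]
  have h1 : ContDiff ℝ ∞ fun x : Fin m → ℝ => sectionRep t₀ f (y, x) :=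
    contDiffOn_univ.1 ((hf t₀).comp (f := fun x => (y, x)) (by fun_prop) fun x _ => ⟨hy, trivial⟩)
  refine Eq.trans (integral_congr_ae (Filter.Eventually.of_forall fun x => ?_))
    (integral_deriv_torus (h := fun x => chartRep t₀ (slice f x) y) (h1.of_le (by simp)) k)
  obtain ⟨x, rfl⟩ := torusMk_surjective x
  refine (chartRep_torusDeriv t₀ k hf (p := (y, x)) hy).trans ?_
  have hd := ((hf.contDiffAt t₀ (p := (y, x)) hy).differentiableAt (by simp)).hasFDerivAt
  have hl : HasDerivAt (fun s : ℝ => ((y, x + s • Pi.single k 1) :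
      EuclideanSpace ℝ (Fin n) × (Fin m → ℝ))) (0, Pi.single k 1) 0 :=
    (hasDerivAt_const _ _).prodMk
      (by simpa using ((hasDerivAt_id (0 : ℝ)).smul_const (Pi.single k 1 : Fin m → ℝ)).const_add x)
  have h2 : HasFDerivAt (sectionRep t₀ f) (fderiv ℝ (sectionRep t₀ f) (y, x))
      (y, x + (0 : ℝ) • (Pi.single k 1 : Fin m → ℝ)) := by simpa using hd
  simp_rw [torusMk_add_single]
  exact (h2.comp_hasDerivAt (0 : ℝ) hl).deriv.symm

theorem average_dT [IsManifold (𝓡 n) ∞ M] {f : RawSection n m M q} (hf : IsSmoothSection f) :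
    average (dT f) = extD (average f) := by
  refine form_ext fun t₀ y hy => ?_
  have hO := isOpen_extChartAt_target (I := 𝓡 n) t₀
  have hi := integrable_torus (g := fun y x => fderiv ℝ (fun z => chartRep t₀ (slice f x) z) y) hO
    (contDiffOn_fderiv_left (r := 0) (g := fun y x => chartRep t₀ (slice f x) y) hO
      ((hf t₀).of_le (show (0 : ℕ∞ω) + 1 ≤ ∞ by simp))).continuousOn hy
  have hd := hasFDerivAt_integral_torus (g := fun y x => chartRep t₀ (slice f x) y) hO
    ((hf t₀).of_le (show 1 ≤ ∞ by simp)) hy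
  have he : chartRep t₀ (average f) =ᶠ[𝓝 y] fun z => ∫ x : Torus m, chartRep t₀ (slice f x) z := by
    filter_upwards [hO.mem_nhds hy] with z hz using chartRep_average t₀ f hz
  rw [chartRep_extD t₀ hf.average hy, he.extDeriv_eq, extDeriv, hd.fderiv,
    chartRep_average t₀ _ hy]
  have hc := ContinuousLinearMap.integral_comp_comm (𝕜 := ℝ)
    (Fₗ := EuclideanSpace ℝ (Fin n) [⋀^Fin (q + 1)]→L[ℝ] ℂ)
    (ContinuousAlternatingMap.alternatizeUncurryFinCLM ℝ (EuclideanSpace ℝ (Fin n)) ℂ) hi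
  rw [ContinuousAlternatingMap.alternatizeUncurryFinCLM_apply] at hc
  refine Eq.trans ?_ hc
  exact integral_congr_ae (Filter.Eventually.of_forall fun x => chartRep_extD t₀ (hf.slice x) hy)

theorem average_zero : average (0 : RawSection n m M q) = 0 :=
  funext fun _ => integral_zero (Torus m) (EuclideanSpace ℝ (Fin n) [⋀^Fin q]→L[ℝ] ℂ)

theorem wedge_zero (w : RawForm n M 1) : wedge w (0 : RawForm n M q) = 0 :=
  funext fun t => (wedgeOneCLM (w t)).map_zero

theorem average_sum [IsManifold (𝓡 n) ∞ M] {ι : Type*} (s : Finset ι)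
    {f : ι → RawSection n m M q} (hf : ∀ k, IsSmoothSection (f k)) :
    average (∑ k ∈ s, f k) = ∑ k ∈ s, average (f k) := by
  classical
  have hs : ∀ s : Finset ι, IsSmoothSection (∑ k ∈ s, f k) := fun s =>
    (smoothSections n m M q).sum_mem fun k _ => hf k
  induction s using Finset.induction_on with
  | empty => exact average_zero
  | insert a s ha ih =>
    rw [Finset.sum_insert ha, Finset.sum_insert ha, average_add (hf a) (hs s), ih]

/-- Averaging intertwines `d'` and `d`, because the terms `w_k ∧ ∂f/∂x_k` have average zero. -/
theorem average_dPrimeRaw [IsManifold (𝓡 n) ∞ M] {w : Fin m → RawForm n M 1}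
    (hw : ∀ k, IsSmoothForm (w k)) {f : RawSection n m M q} (hf : IsSmoothSection f) :
    average (dPrimeRaw w f) = extD (average f) := by
  have hk : ∀ k, IsSmoothSection (sectionWedge (w k) (torusDeriv k f)) := fun k =>
    (hf.torusDeriv k).sectionWedge (hw k)
  have h0 : ∀ k, average (sectionWedge (w k) (torusDeriv k f)) = 0 := fun k => by
    rw [average_sectionWedge _ (hf.torusDeriv k), average_torusDeriv k hf, wedge_zero]
  have hs : IsSmoothSection (∑ k, sectionWedge (w k) (torusDeriv k f)) :=
    (smoothSections n m M (q + 1)).sum_mem fun k _ => hk k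
  change average (dT f + ∑ k, sectionWedge (w k) (torusDeriv k f)) = _
  rw [average_add hf.dT hs, average_sum _ hk, Finset.sum_congr rfl fun k _ => h0 k,
    Finset.sum_const_zero, add_zero, average_dT hf]

/-! ### Fourier coefficients and the operator `d'` -/

theorem charMul_charMul (ξ η : Fin m → ℤ) (f : RawSection n m M q) :
    charMul ξ (charMul η f) = charMul (ξ + η) f := by
  funext p
  simp only [charMul, smul_smul, torusChar_add]

theorem charMul_zero (f : RawSection n m M q) : charMul 0 f = f := by
  funext p
  simp only [charMul, torusChar_zero, one_smul]

/-- The Fourier coefficient of index `ξ` intertwines `d'` and `d'_ξ`. -/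
theorem average_charMul_dPrimeRaw [IsManifold (𝓡 n) ∞ M] {w : Fin m → RawForm n M 1}
    (hw : ∀ k, IsSmoothForm (w k)) (ξ : Fin m → ℤ) {f : RawSection n m M q}
    (hf : IsSmoothSection f) :
    average (charMul (-ξ) (dPrimeRaw w f)) = extD (average (charMul (-ξ) f)) +
      Complex.I • wedge (∑ k, (ξ k : ℂ) • w k) (average (charMul (-ξ) f)) := by
  have hg := hf.charMul (-ξ)
  -- apply the conjugation formula to `e^{-ixξ} f`, whose product with `e^{ixξ}` is `f`
  have hf' : f = charMul ξ (charMul (-ξ) f) := by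
    rw [charMul_charMul, add_neg_cancel, charMul_zero]
  have hW : IsSmoothForm (∑ k, (ξ k : ℂ) • w k) :=
    (smoothForms n M 1).sum_mem fun k _ => (smoothForms n M 1).smul_mem _ (hw k)
  have h1 : charMul (-ξ) (dPrimeRaw w f) = dPrimeRaw w (charMul (-ξ) f) +
      Complex.I • sectionWedge (∑ k, (ξ k : ℂ) • w k) (charMul (-ξ) f) := by
    conv_lhs => rw [hf', dPrimeRaw_charMul w ξ hg, charMul_charMul, neg_add_cancel, charMul_zero]
  rw [h1, average_add (hg.dPrimeRaw hw) ((hg.sectionWedge hW).smul _), average_smul,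
    average_dPrimeRaw hw hg, average_sectionWedge _ hg]

/-- The pullback to `M × 𝕋^m` of a form of `M`. -/
def constSection (m : ℕ) (f : RawForm n M q) : RawSection n m M q := fun p => f p.1

theorem IsSmoothForm.constSection {f : RawForm n M q} (hf : IsSmoothForm f) :
    IsSmoothSection (constSection m f) := fun t₀ =>
  (hf t₀).comp contDiffOn_fst fun _ hp => hp.1

theorem dPrimeRaw_constSection (w : Fin m → RawForm n M 1) (f : RawForm n M q) :
    dPrimeRaw w (constSection m f) = constSection m (extD f) := by
  have h1 : ∀ k, torusDeriv k (constSection m f) = 0 := fun k => by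
    funext p
    exact deriv_const (0 : ℝ) (show EuclideanSpace ℝ (Fin n) [⋀^Fin q]→L[ℝ] ℂ from f p.1)
  have h2 : ∀ k, (fun p : M × Torus m => wedge (w k) (slice (torusDeriv k (constSection m f)) p.2)
      p.1) = (0 : RawSection n m M (q + 1)) := fun k => by
    funext p
    rw [h1]
    exact congrFun (wedge_zero (w k)) p.1
  rw [dPrimeRaw, Finset.sum_congr rfl fun k _ => h2 k, Finset.sum_const_zero, add_zero]
  rfl

theorem embedRaw_eq (ξ : Fin m → ℤ) (f : RawForm n M q) :
    embedRaw ξ f = ((2 * Real.pi : ℂ) ^ m)⁻¹ • charMul ξ (constSection m f) :=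
  funext fun p => mul_smul _ _ (f p.1)

theorem dPrimeRaw_embedRaw [IsManifold (𝓡 n) ∞ M] (w : Fin m → RawForm n M 1) (ξ : Fin m → ℤ)
    {f : RawForm n M q} (hf : IsSmoothForm f) :
    dPrimeRaw w (embedRaw ξ f) =
      embedRaw ξ (extD f + Complex.I • wedge (∑ k, (ξ k : ℂ) • w k) f) := by
  rw [embedRaw_eq, embedRaw_eq, dPrimeRaw_smul w _ (hf.constSection.charMul ξ),
    dPrimeRaw_charMul w ξ hf.constSection, dPrimeRaw_constSection]
  rfl

/-- Orthogonality of the characters: the Fourier coefficient of index `η` of `E_ξ f` is `f` for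
`ξ = η` and zero otherwise. The factor `(2π)^{-m}` in `E_ξ` cancels the mass of the torus. -/
theorem average_charMul_embedRaw (ξ η : Fin m → ℤ) (f : RawForm n M q) :
    average (charMul (-η) (embedRaw ξ f)) = if ξ = η then f else 0 := by
  funext t
  have hpi : ((2 * Real.pi : ℂ) ^ m) ≠ 0 := by simp [Real.pi_ne_zero]
  have h1 : ∀ x : Torus m, charMul (-η) (embedRaw ξ f) (t, x) =
      torusChar (ξ - η) x • ((2 * Real.pi : ℂ) ^ m)⁻¹ • f t := fun x => by
    simp only [charMul, embedRaw, smul_smul, sub_eq_neg_add, torusChar_add]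
    congr 1
    ring
  have h2 := integral_smul_const (μ := volume) (fun x : Torus m => torusChar (ξ - η) x)
    (((2 * Real.pi : ℂ) ^ m)⁻¹ • (show EuclideanSpace ℝ (Fin n) [⋀^Fin q]→L[ℝ] ℂ from f t))
  refine (congrArg (fun h : Torus m → EuclideanSpace ℝ (Fin n) [⋀^Fin q]→L[ℝ] ℂ => ∫ x, h x)
    (funext h1)).trans (h2.trans ?_)
  rw [integral_torusChar]
  simp only [sub_eq_zero]
  split_ifs with h
  · exact smul_inv_smul₀ hpi _
  · exact zero_smul ℂ _

/-! ### The Fourier coefficients as chain maps -/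

theorem SmoothForm.coe_sum_smul (w : Fin m → SmoothForm n M 1) (c : Fin m → ℂ) :
    (∑ k, c k • w k : SmoothForm n M 1).1 = ∑ k, c k • (w k).1 := by
  refine (map_sum (smoothForms n M 1).subtype (fun k => c k • w k) Finset.univ).trans ?_
  rfl

variable [IsManifold (𝓡 n) ∞ M]

/-- The Fourier coefficient `f ↦ ∫ e^{-i x ξ} f(·, x) dx` of index `ξ` of a section. -/
def fourierCoeffMap (ξ : Fin m → ℤ) (q : ℕ) : SmoothSection n m M q →ₗ[ℂ] SmoothForm n M q where
  toFun f := ⟨average (charMul (-ξ) f.1), (IsSmoothSection.charMul (-ξ) f.2).average⟩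
  map_add' f g := Subtype.ext <| by
    refine Eq.trans (congrArg average ?_) (average_add (IsSmoothSection.charMul (-ξ) f.2)
      (IsSmoothSection.charMul (-ξ) g.2))
    exact funext fun p => smul_add _ (f.1 p) (g.1 p)
  map_smul' c f := Subtype.ext <| by
    refine Eq.trans (congrArg average ?_) (average_smul c _)
    exact funext fun p => smul_comm _ c (f.1 p)

theorem fourierCoeffMap_dPrime (w : Fin m → SmoothForm n M 1) (ξ : Fin m → ℤ)
    (q : ℕ) (f : SmoothSection n m M q) :
    dXi w ξ q (fourierCoeffMap ξ q f) = fourierCoeffMap ξ (q + 1) (dPrime w q f) := by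
  refine Subtype.ext ?_
  refine Eq.trans ?_ (average_charMul_dPrimeRaw (fun k => (w k).2) ξ f.2).symm
  rw [← SmoothForm.coe_sum_smul]
  rfl

theorem embed_dXi (w : Fin m → SmoothForm n M 1) (ξ : Fin m → ℤ)
    (q : ℕ) (f : SmoothForm n M q) :
    dPrime w q (embed ξ q f) = embed ξ (q + 1) (dXi w ξ q f) := by
  refine Subtype.ext ?_
  refine (dPrimeRaw_embedRaw _ ξ f.2).trans ?_
  rw [← SmoothForm.coe_sum_smul]
  rfl

theorem fourierCoeffMap_embed (ξ η : Fin m → ℤ) (q : ℕ) (f : SmoothForm n M q) :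
    fourierCoeffMap η q (embed ξ q f) = if ξ = η then f else 0 := by
  refine Subtype.ext ((average_charMul_embedRaw ξ η f.1).trans ?_)
  split_ifs <;> rfl

end Manifold

/-! ### Functoriality of cohomology -/

section Cohomology

variable {A B : ℕ → Type*} [∀ q, AddCommGroup (A q)] [∀ q, Module ℂ (A q)]
  [∀ q, AddCommGroup (B q)] [∀ q, Module ℂ (B q)]
  {dA : ∀ q, A q →ₗ[ℂ] A (q + 1)} {dB : ∀ q, B q →ₗ[ℂ] B (q + 1)}

/-- The restriction of a chain map to cocycles. -/
def cocycleMap (F : ∀ q, A q →ₗ[ℂ] B q) (hF : ∀ q a, dB q (F q a) = F (q + 1) (dA q a)) (q : ℕ) :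
    LinearMap.ker (dA q) →ₗ[ℂ] LinearMap.ker (dB q) :=
  (F q).restrict fun a ha => by
    rw [LinearMap.mem_ker] at ha ⊢
    rw [hF, ha, map_zero]

/-- The map induced in cohomology by a chain map. -/
def Cohomology.map (F : ∀ q, A q →ₗ[ℂ] B q) (hF : ∀ q a, dB q (F q a) = F (q + 1) (dA q a))
    (q : ℕ) : Cohomology dA q →ₗ[ℂ] Cohomology dB q :=
  Submodule.mapQ _ _ (cocycleMap F hF q) <| by
    rintro ⟨a, ha⟩ h
    change F q a ∈ coboundaries dB q
    change a ∈ coboundaries dA q at h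
    cases q with
    | zero =>
      rw [(Submodule.mem_bot ℂ).1 h, map_zero]
      exact Submodule.zero_mem _
    | succ q =>
      obtain ⟨b, rfl⟩ := h
      exact ⟨F q b, hF q b⟩

end Cohomology

/-- A family of linear maps `Φ i` with linear maps `Ψ j` such that `Ψ j ∘ Φ i` is the identity for
`i = j` and zero otherwise is jointly injective. -/
theorem injective_toModule_of_dual {ι R N : Type*} [DecidableEq ι] [Semiring R] {P : ι → Type*}
    [∀ i, AddCommGroup (P i)] [∀ i, Module R (P i)] [AddCommGroup N] [Module R N]
    (Φ : ∀ i, P i →ₗ[R] N) (Ψ : ∀ i, N →ₗ[R] P i) (h1 : ∀ i a, Ψ i (Φ i a) = a)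
    (h2 : ∀ i j, i ≠ j → ∀ a, Ψ j (Φ i a) = 0) :
    Function.Injective (DirectSum.toModule R ι N Φ) := by
  have key : ∀ j, Ψ j ∘ₗ DirectSum.toModule R ι N Φ = DirectSum.component R ι P j := fun j => by
    refine DirectSum.linearMap_ext R fun i => LinearMap.ext fun a => ?_
    rw [LinearMap.comp_apply, LinearMap.comp_apply, LinearMap.comp_apply,
      DirectSum.toModule_lof]
    rcases eq_or_ne i j with rfl | hij
    · rw [h1, DirectSum.component.lof_self]
    · rw [h2 i j hij, DirectSum.component.of, dif_neg hij]
  intro a b hab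
  refine DirectSum.ext_component R fun j => ?_
  rw [← key j, LinearMap.comp_apply, LinearMap.comp_apply, hab]

end TubeStructure
end

theorem mainTheorem10 {n m : ℕ} {M : Type*} [TopologicalSpace M]
    [ChartedSpace (EuclideanSpace ℝ (Fin n)) M] [IsManifold (𝓡 n) ∞ M]
    [T2Space M] [CompactSpace M] [ConnectedSpace M]
    (w : Fin m → TubeStructure.SmoothForm n M 1)
    (hw : ∀ k, TubeStructure.dForm 1 (w k) = 0) (q : ℕ) :
    ∃ Φ : (ξ : Fin m → ℤ) → TubeStructure.HXi w ξ q →ₗ[ℂ] TubeStructure.HPrime w q,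
      (∀ (ξ : Fin m → ℤ) (f : LinearMap.ker (TubeStructure.dXi w ξ q)),
        ∃ hf : TubeStructure.embed ξ q (f : TubeStructure.SmoothForm n M q) ∈
            LinearMap.ker (TubeStructure.dPrime w q),
          Φ ξ (TubeStructure.Cohomology.mk (TubeStructure.dXi w ξ) q f) =
            TubeStructure.Cohomology.mk (TubeStructure.dPrime w) q
              ⟨TubeStructure.embed ξ q (f : TubeStructure.SmoothForm n M q), hf⟩) ∧
      (∀ ξ : Fin m → ℤ, Function.Injective (Φ ξ)) ∧
      Function.Injective
        (DirectSum.toModule ℂ (Fin m → ℤ) (TubeStructure.HPrime w q) Φ) := by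
  let Φ : (ξ : Fin m → ℤ) → TubeStructure.HXi w ξ q →ₗ[ℂ] TubeStructure.HPrime w q := fun ξ =>
    TubeStructure.Cohomology.map (TubeStructure.embed ξ) (TubeStructure.embed_dXi w ξ) q
  let Ψ : (ξ : Fin m → ℤ) → TubeStructure.HPrime w q →ₗ[ℂ] TubeStructure.HXi w ξ q := fun ξ =>
    TubeStructure.Cohomology.map (TubeStructure.fourierCoeffMap ξ)
      (TubeStructure.fourierCoeffMap_dPrime w ξ) q
  have h1 : ∀ ξ a, Ψ ξ (Φ ξ a) = a := by
    intro ξ a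
    obtain ⟨f, rfl⟩ := Submodule.mkQ_surjective _ a
    refine congrArg (Submodule.mkQ _) (Subtype.ext ?_)
    exact (TubeStructure.fourierCoeffMap_embed ξ ξ q f.1).trans (if_pos rfl)
  have h2 : ∀ ξ η, ξ ≠ η → ∀ a, Ψ η (Φ ξ a) = 0 := by
    intro ξ η hne a
    obtain ⟨f, rfl⟩ := Submodule.mkQ_surjective _ a
    refine (congrArg (Submodule.mkQ _) (Subtype.ext ?_)).trans (map_zero _)
    exact (TubeStructure.fourierCoeffMap_embed ξ η q f.1).trans (if_neg hne)
  exact ⟨Φ, fun ξ f => ⟨(TubeStructure.cocycleMap (TubeStructure.embed ξ)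
    (TubeStructure.embed_dXi w ξ) q f).2, rfl⟩,
    fun ξ => Function.LeftInverse.injective (h1 ξ),
    TubeStructure.injective_toModule_of_dual Φ Ψ h1 h2⟩
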